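/- Let $Q$ denote the position operator and $P$ the momentum operator on $L^2(\mathbb{R})$. Let $d\ge 2$ be an integer, put $c_d = d \bmod 2$ and $\varepsilon_d = 1/(2d)$. \emph{Codes.} For $\kappa,\Delta>0$ let $\eta_\kappa(x)=\frac{\sqrt\kappa}{\pi^{1/4}}e^{-\kappa^2x^2/2}$ and $\Psi_\Delta(x)=\frac{1}{\pi^{1/4}\sqrt\Delta}e^{-x^2/(2\Delta^2)}$, and let $\Psi_\Delta^{\varepsilon_d}=\mathbf 1_{[-\varepsilon_d,\varepsilon_d]}\Psi_\Delta/\|\mathbf 1_{[-\varepsilon_d,\varepsilon_d]}\Psi_\Delta\|_{L^2}$. Let $\mathsf{GKP}_{\kappa,\Delta}(x)=C\sum_{z\in\mathbb Z}\eta_\kappa(z)\Psi_\Delta^{\varepsilon_d}(x-z)$, where $C>0$ is such that this function has $L^2$-norm $1$. For $j\in\{0,\dots,d-1\}$ let $\mathsf{GKP}_{\kappa,\Delta}(j)_d=e^{-ij\sqrt{2\pi/d}\,P}M_{\sqrt{2\pi d}}\,\mathsf{GKP}_{\kappa,\Delta}$, where $(M_\alpha f)(x)=\alpha^{-1/2}f(x/\alpha)$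 and $(e^{-iaP}f)(x)=f(x-a)$. These $d$ functions are orthonormal; their span is the code $\mathcal L^\star_{\kappa,\Delta}[d]\subset L^2(\mathbb R)$, with isometric encoding map $\mathsf{Enc}:\mathbb C^d\to\mathcal L^\star_{\kappa,\Delta}[d]$, $|j\rangle\mapsto\mathsf{GKP}_{\kappa,\Delta}(j)_d$. \emph{Gate error.} Let $\mathcal L$ be a code with unitary encoding map $\mathsf{Enc}:\mathbb C^d\to\mathcal L\subset L^2(\mathbb R)$, let $U$ be a unitary on $\mathbb C^d$ and $W$ a unitary on $L^2(\mathbb R)$. Put $\mathcal W(\rho)=W\rho W^\dagger$, $\overline U=\mathsf{Enc}\,U\,\mathsf{Enc}^{-1}:\mathcal L\to\mathcal L$, $\overline{\mathcal U}(\rho)=\overline U\rho\,\overline U^\dagger$ and $\Pi_{\mathcal L}(\rho)=\pi_{\mathcal L}\rho\,\pi_{\mathcal L}$, where $\pi_{\mathcal L}$ is the orthogonal projection onto $\mathcal L$. The logical gate error is $$\mathsf{err}_{\mathcal L}(W,U)=\big\|(\mathcal W-\overline{\mathcal U})\circ\Pi_{\mathcal L}\big\|_\diamond,\qquad \|\mathcal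 E\|_\diamond=\sup_{n\in\mathbb N}\ \sup_{\|X\|_1\le 1}\big\|(\mathcal E\otimes\mathrm{id}_{\mathcal B(\mathbb C^n)})(X)\big\|_1,$$ where $\|X\|_1=\operatorname{tr}\sqrt{X^\dagger X}$. \emph{Statement.} Let $\mathsf P$ be the phase gate on $\mathbb C^d$, $\mathsf P|x\rangle=e^{i\pi x(x+c_d)/d}|x\rangle$ for $x\in\{0,\dots,d-1\}$, and let $W_{\mathsf P}=e^{i(Q^2+c_d\sqrt{2\pi/d}\,Q)/2}$. Let $\kappa,\Delta,\nu>0$ satisfy $$\Delta\le\frac1{80d}\qquad\text{and}\qquad\kappa\le d^{-(6+\nu)},$$ and put $(\kappa',\Delta')=(2\pi d\Delta,\ \kappa/(2\pi d))$. Then $$\max\Big\{\mathsf{err}_{\mathcal L^\star_{\kappa,\Delta}[d]}(W_{\mathsf P},\mathsf P),\ \mathsf{err}_{\mathcal L^\star_{\kappa',\Delta'}[d]}(W_{\mathsf P},\mathsf P)\Big\}\ \ge\ \frac1{50}.$$ -/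

import Mathlib

open MeasureTheory
open scoped ENNReal InnerProductSpace

noncomputable section

namespace GKP

section Channels

variable {H K : Type*} [NormedAddCommGroup H] [InnerProductSpace ℂ H] [CompleteSpace H]
  [NormedAddCommGroup K] [InnerProductSpace ℂ K] [CompleteSpace K]

/-- The trace norm `‖T‖₁ = tr |T|`, where `|T| = √(T† T)`, with values in `[0, ∞]`. The trace of the
positive operator `|T|` is written as the supremum of `∑ᵢ ⟨eᵢ, |T| eᵢ⟩` over all finite orthonormal
families; `traceNorm_eq_tsum` shows that this is the sum over any Hilbert basis. -/
def traceNorm (T : H →L[ℂ] H) : ℝ≥0∞ :=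
  ⨆ (n : ℕ) (e : Fin n → H) (_ : Orthonormal ℂ e),
    ∑ i, ENNReal.ofReal (RCLike.re ⟪e i, CFC.abs T (e i)⟫_ℂ)

theorem ofReal_re_inner_abs (T : H →L[ℂ] H) (x : H) :
    ENNReal.ofReal (RCLike.re ⟪x, CFC.abs T x⟫_ℂ) =
      ENNReal.ofReal (‖CFC.sqrt (CFC.abs T) x‖ ^ 2) := by
  set S := CFC.sqrt (CFC.abs T) with hS
  have h1 : S * S = CFC.abs T := CFC.sqrt_mul_sqrt_self _ (CFC.abs_nonneg T)
  have h2 : S.adjoint = S := (CFC.sqrt_nonneg (CFC.abs T)).isSelfAdjoint.star_eq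
  rw [← h1, mul_apply_eq_comp, ← ContinuousLinearMap.adjoint_inner_left, h2,
    inner_self_eq_norm_sq]

theorem hilbertBasis_tsum {E ι : Type*} [NormedAddCommGroup E] [InnerProductSpace ℂ E]
    (b : HilbertBasis ι ℂ E) (x : E) :
    ENNReal.ofReal (‖x‖ ^ 2) = ∑' i, ENNReal.ofReal (‖⟪b i, x⟫_ℂ‖ ^ 2) := by
  have h' : HasSum (fun i => ‖⟪b i, x⟫_ℂ‖ ^ 2) (‖x‖ ^ 2) := by
    have := (RCLike.reCLM (K := ℂ)).hasSum (b.hasSum_inner_mul_inner x x)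
    simp only [RCLike.reCLM_apply, inner_self_eq_norm_sq, inner_mul_symm_re_eq_norm, norm_mul] at this
    have e : (fun i => ‖⟪b i, x⟫_ℂ‖ ^ 2) = fun i => ‖⟪x, b i⟫_ℂ‖ * ‖⟪b i, x⟫_ℂ‖ := by
      ext i; rw [norm_inner_symm x (b i), sq]
    rw [e]; exact this
  rw [← h'.tsum_eq, ENNReal.ofReal_tsum_of_nonneg (fun _ => sq_nonneg _) h'.summable]

theorem traceNorm_eq_tsum {ι : Type*} (b : HilbertBasis ι ℂ H) (T : H →L[ℂ] H) :
    traceNorm T = ∑' i, ENNReal.ofReal (RCLike.re ⟪b i, CFC.abs T (b i)⟫_ℂ) := by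
  refine le_antisymm ?_ ?_
  · refine iSup_le fun n => iSup_le fun e => iSup_le fun he => ?_
    simp only [ofReal_re_inner_abs]
    set S := CFC.sqrt (CFC.abs T) with hS
    have h2 : S.adjoint = S := (CFC.sqrt_nonneg (CFC.abs T)).isSelfAdjoint.star_eq
    calc ∑ i, ENNReal.ofReal (‖S (e i)‖ ^ 2)
        = ∑ i, ∑' j, ENNReal.ofReal (‖⟪b j, S (e i)⟫_ℂ‖ ^ 2) := by
          simp only [hilbertBasis_tsum b]
      _ = ∑' j, ∑ i, ENNReal.ofReal (‖⟪b j, S (e i)⟫_ℂ‖ ^ 2) :=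
          (Summable.tsum_finsetSum fun _ _ => ENNReal.summable).symm
      _ ≤ ∑' j, ENNReal.ofReal (‖S (b j)‖ ^ 2) := by
          refine ENNReal.tsum_le_tsum fun j => ?_
          rw [← ENNReal.ofReal_sum_of_nonneg fun _ _ => sq_nonneg _]
          refine ENNReal.ofReal_le_ofReal ?_
          refine le_trans (le_of_eq ?_) (he.sum_inner_products_le (S (b j)) (s := Finset.univ))
          refine Finset.sum_congr rfl fun i _ => ?_
          rw [← ContinuousLinearMap.adjoint_inner_left, h2, norm_inner_symm]
  · rw [ENNReal.tsum_eq_iSup_sum]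
    refine iSup_le fun s => ?_
    let f := s.equivFin.symm
    have he : Orthonormal ℂ (fun k => b (f k)) :=
      b.orthonormal.comp _ (Subtype.val_injective.comp f.injective)
    refine le_trans (le_of_eq ?_) (le_iSup_of_le s.card (le_iSup_of_le _ (le_iSup_of_le he le_rfl)))
    rw [← Finset.sum_coe_sort]
    exact (f.sum_comp (fun i : s => ENNReal.ofReal (RCLike.re ⟪b i, CFC.abs T (b i)⟫_ℂ))).symm

/-- The completely positive map `X ↦ A X A†`. -/
def conjMap (A : H →L[ℂ] K) : (H →L[ℂ] H) →ₗ[ℂ] (K →L[ℂ] K) where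
  toFun X := A ∘L X ∘L A.adjoint
  map_add' X Y := by ext x; simp
  map_smul' c X := by ext x; simp

/-- The Hilbert space `H ⊗ ℂⁿ`, realized as the Hilbert sum of `n` copies of `H`. -/
abbrev Copies (n : ℕ) (H : Type*) [NormedAddCommGroup H] : Type _ := PiLp 2 (fun _ : Fin n => H)

/-- The map `1 ⊗ ⟨i| : H ⊗ ℂⁿ → H`; its adjoint is the inclusion `1 ⊗ |i⟩` of the `i`-th copy. -/
def coord (n : ℕ) (i : Fin n) : Copies n H →L[ℂ] H := PiLp.proj 2 (fun _ : Fin n => H) i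

/-- The map `E ⊗ id` on operators on `H ⊗ ℂⁿ`: writing `X = ∑ᵢⱼ Xᵢⱼ ⊗ |i⟩⟨j|`, it maps `X` to
`∑ᵢⱼ E(Xᵢⱼ) ⊗ |i⟩⟨j|`. -/
def ampliation (n : ℕ) (E : (H →L[ℂ] H) →ₗ[ℂ] (K →L[ℂ] K))
    (X : Copies n H →L[ℂ] Copies n H) : Copies n K →L[ℂ] Copies n K :=
  ∑ i, ∑ j, (coord n i).adjoint ∘L E (coord n i ∘L X ∘L (coord n j).adjoint) ∘L coord n j

/-- The diamond norm `sup_n ‖E ⊗ id_{B(ℂⁿ)}‖₁`, where the norm of a map of operators is taken with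
respect to the trace norm. -/
def diamondNorm (E : (H →L[ℂ] H) →ₗ[ℂ] (K →L[ℂ] K)) : ℝ≥0∞ :=
  ⨆ (n : ℕ) (X : Copies n H →L[ℂ] Copies n H) (_ : traceNorm X ≤ 1), traceNorm (ampliation n E X)

variable {d : ℕ} (enc : EuclideanSpace ℂ (Fin d) →ₗᵢ[ℂ] H)

/-- The code space `L ⊆ H`: the image of the isometric encoding map. -/
abbrev codeSpace : Submodule ℂ H := LinearMap.range enc.toLinearMap

/-- The encoding map as a unitary `ℂᵈ → L`; its inverse is the decoding map. -/
def encodeIso : EuclideanSpace ℂ (Fin d) ≃ₗᵢ[ℂ] codeSpace enc := enc.equivRange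

/-- The logical gate `Enc U Dec : L → L`. -/
def encodedGate (U : Matrix.unitaryGroup (Fin d) ℂ) : codeSpace enc →L[ℂ] codeSpace enc :=
  (encodeIso enc).toContinuousLinearEquiv.toContinuousLinearMap ∘L
    Matrix.toEuclideanCLM (𝕜 := ℂ) (U : Matrix (Fin d) (Fin d) ℂ) ∘L
      (encodeIso enc).symm.toContinuousLinearEquiv.toContinuousLinearMap

/-- The composable logical gate error `err_L(W, U) = ‖(𝒲 - 𝒰) ∘ Π_L‖_⋄` of the implementation
`𝒲(ρ) = W ρ W†` of the logical gate `𝒰(ρ) = Ū ρ Ū†` with `Ū = Enc U Dec`. Here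
`Π_L(ρ) = π_L ρ π_L†` maps `B(H)` to `B(L)`, and `B(L)` is regarded as a subset of `B(H)` through
conjugation with the inclusion of `L` in `H`. -/
def gateError (W : H ≃ₗᵢ[ℂ] H) (U : Matrix.unitaryGroup (Fin d) ℂ) : ℝ≥0∞ :=
  diamondNorm
    ((conjMap W.toContinuousLinearEquiv.toContinuousLinearMap ∘ₗ
          conjMap (codeSpace enc).subtypeL
        - conjMap (codeSpace enc).subtypeL ∘ₗ conjMap (encodedGate enc U)) ∘ₗ
      conjMap (codeSpace enc).orthogonalProjectionOnto)

end Channels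

section States

/-- The Gaussian envelope `η_κ` of width `1/κ`. -/
def envelope (κ x : ℝ) : ℝ :=
  √κ / Real.pi ^ (1 / 4 : ℝ) * Real.exp (-κ ^ 2 * x ^ 2 / 2)

/-- The Gaussian peak `Ψ_Δ` of width `Δ`. -/
def peak (Δ x : ℝ) : ℝ :=
  1 / (Real.pi ^ (1 / 4 : ℝ) * √Δ) * Real.exp (-x ^ 2 / (2 * Δ ^ 2))

/-- The `L²(ℝ)`-norm of a square-integrable function. -/
def l2norm (f : ℝ → ℝ) : ℝ := √(∫ x, f x ^ 2)

/-- The normalization of a square-integrable function. -/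
def normalize (f : ℝ → ℝ) (x : ℝ) : ℝ := (l2norm f)⁻¹ * f x

/-- The truncated Gaussian peak `Ψ_Δ^ε = Π_{[-ε,ε]} Ψ_Δ / ‖Π_{[-ε,ε]} Ψ_Δ‖`. -/
def truncPeak (Δ ε : ℝ) : ℝ → ℝ := normalize ((Set.Icc (-ε) ε).indicator (peak Δ))

/-- `∑_{z ∈ ℤ} η_κ(z) χ_Δ^ε(z)` with `χ_Δ^ε(z)(x) = Ψ_Δ^ε(x - z)`. -/
def comb (κ Δ ε x : ℝ) : ℝ := ∑' z : ℤ, envelope κ z * truncPeak Δ ε (x - z)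

/-- The truncated approximate GKP state `GKP_{κ,Δ}^ε = C_κ ∑_z η_κ(z) χ_Δ^ε(z)` (integer spacing),
with the constant `C_κ > 0` that normalizes it. -/
def gkpInt (κ Δ ε : ℝ) : ℝ → ℝ := normalize (comb κ Δ ε)

/-- The squeezing unitary `M_α = e^{-i (log α) (QP + PQ)/2}` on wave functions. -/
def squeeze (α : ℝ) (f : ℝ → ℝ) (x : ℝ) : ℝ := 1 / √α * f (x / α)

/-- The displacement `e^{-iaP}` on wave functions. -/
def displace (a : ℝ) (f : ℝ → ℝ) (x : ℝ) : ℝ := f (x - a)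

/-- The wave function of `GKP_{κ,Δ}^ε(j)_d = e^{-ij√(2π/d)P} M_{√(2πd)} GKP_{κ,Δ}^ε`. -/
def gkpFun (κ Δ ε : ℝ) (d j : ℕ) : ℝ → ℝ :=
  displace (j * √(2 * Real.pi / d)) (squeeze √(2 * Real.pi * d) (gkpInt κ Δ ε))

theorem peak_pos {Δ : ℝ} (hΔ : 0 < Δ) (x : ℝ) : 0 < peak Δ x := by
  unfold peak; positivity

theorem peak_le {Δ : ℝ} (hΔ : 0 < Δ) (x : ℝ) : peak Δ x ≤ peak Δ 0 := by
  unfold peak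
  refine mul_le_mul_of_nonneg_left (Real.exp_le_exp.2 ?_) (by positivity)
  rw [neg_div, neg_div, neg_le_neg_iff]
  simp only [ne_eq, OfNat.ofNat_ne_zero, not_false_eq_true, zero_pow, zero_div]
  positivity

theorem continuous_peak (Δ : ℝ) : Continuous (peak Δ) := by
  unfold peak; fun_prop

theorem continuous_envelope (κ : ℝ) : Continuous (envelope κ) := by
  unfold envelope; fun_prop

theorem truncPeak_of_abs_gt {Δ ε x : ℝ} (hx : ε < |x|) : truncPeak Δ ε x = 0 := by
  have : x ∉ Set.Icc (-ε) ε := fun h => absurd (abs_le.2 h) (not_le.2 hx)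
  simp [truncPeak, normalize, this]

theorem truncPeak_nonneg {Δ : ℝ} (hΔ : 0 < Δ) (ε x : ℝ) : 0 ≤ truncPeak Δ ε x :=
  mul_nonneg (inv_nonneg.2 (Real.sqrt_nonneg _))
    (Set.indicator_nonneg (fun y _ => (peak_pos hΔ y).le) x)

theorem truncPeak_pos {Δ ε x : ℝ} (hΔ : 0 < Δ) (hε : 0 < ε) (hx : |x| ≤ ε) :
    0 < truncPeak Δ ε x := by
  have hpos : 0 < ∫ y, (Set.Icc (-ε) ε).indicator (peak Δ) y ^ 2 := by
    have : (fun y => (Set.Icc (-ε) ε).indicator (peak Δ) y ^ 2) =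
        (Set.Icc (-ε) ε).indicator (fun y => peak Δ y ^ 2) := by
      ext y; by_cases h : y ∈ Set.Icc (-ε) ε <;> simp [h]
    rw [this, integral_indicator measurableSet_Icc, integral_Icc_eq_integral_Ioc,
      ← intervalIntegral.integral_of_le (by linarith)]
    refine intervalIntegral.intervalIntegral_pos_of_pos ?_ (fun y => ?_) (by linarith)
    · exact ((continuous_peak Δ).pow 2).intervalIntegrable _ _
    · have := peak_pos hΔ y
      positivity
  have hx' : x ∈ Set.Icc (-ε) ε := abs_le.1 hx
  unfold truncPeak normalize l2norm
  rw [Set.indicator_of_mem hx']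
  exact mul_pos (inv_pos.2 (Real.sqrt_pos.2 hpos)) (peak_pos hΔ x)

theorem truncPeak_le {Δ : ℝ} (hΔ : 0 < Δ) (ε : ℝ) :
    ∃ B, 0 ≤ B ∧ ∀ x, truncPeak Δ ε x ≤ B := by
  refine ⟨(l2norm ((Set.Icc (-ε) ε).indicator (peak Δ)))⁻¹ * peak Δ 0,
    mul_nonneg (inv_nonneg.2 (Real.sqrt_nonneg _)) (peak_pos hΔ 0).le, fun x => ?_⟩
  refine mul_le_mul_of_nonneg_left ?_ (inv_nonneg.2 (Real.sqrt_nonneg _))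
  exact Set.indicator_apply_le' (fun _ => peak_le hΔ x) (fun _ => (peak_pos hΔ 0).le)

theorem measurable_truncPeak (Δ ε : ℝ) : Measurable (truncPeak Δ ε) :=
  ((continuous_peak Δ).measurable.indicator measurableSet_Icc).const_mul _

theorem comb_eq {κ Δ ε : ℝ} (hε : ε < 1 / 2) (x : ℝ) :
    comb κ Δ ε x = envelope κ (round x) * truncPeak Δ ε (x - round x) := by
  refine tsum_eq_single (round x) fun z hz => ?_
  rw [truncPeak_of_abs_gt, mul_zero]
  have h1 : (1 : ℝ) ≤ |(z : ℝ) - round x| := by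
    have : (1 : ℤ) ≤ |z - round x| := Int.one_le_abs (sub_ne_zero.2 hz)
    exact_mod_cast this
  have h2 := abs_sub_round x
  have h3 := abs_sub_le (z : ℝ) x (round x)
  rw [abs_sub_comm (z : ℝ) x] at h3
  linarith

theorem measurable_comb {κ Δ ε : ℝ} (hε : ε < 1 / 2) : Measurable (comb κ Δ ε) := by
  have hr : Measurable (fun x : ℝ => ((round x : ℤ) : ℝ)) := by
    have : (fun x : ℝ => ((round x : ℤ) : ℝ)) = fun x : ℝ => ((⌊x + 1 / 2⌋ : ℤ) : ℝ) := by
      ext x; rw [round_eq]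
    rw [this]
    exact (measurable_from_top (f := fun n : ℤ => (n : ℝ))).comp
      (Int.measurable_floor.comp (measurable_id.add_const _))
  rw [funext (comb_eq hε)]
  exact ((continuous_envelope κ).measurable.comp hr).mul
    ((measurable_truncPeak Δ ε).comp (measurable_id.sub hr))

theorem comb_nonneg {κ Δ ε : ℝ} (hΔ : 0 < Δ) (hε : ε < 1 / 2) (x : ℝ) : 0 ≤ comb κ Δ ε x := by
  rw [comb_eq hε]
  refine mul_nonneg ?_ (truncPeak_nonneg hΔ _ _)
  unfold envelope; positivity

theorem integrable_comb_sq {κ Δ ε : ℝ} (hκ : 0 < κ) (hΔ : 0 < Δ) (hε : ε < 1 / 2) :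
    Integrable (fun x => comb κ Δ ε x ^ 2) := by
  obtain ⟨B, hB, hle⟩ := truncPeak_le hΔ ε
  set c := √κ / Real.pi ^ (1 / 4 : ℝ) with hc
  have hc0 : 0 ≤ c := by positivity
  have hg : Integrable (fun x : ℝ =>
      (c * B) ^ 2 * Real.exp (κ ^ 2 / 4) * Real.exp (-(κ ^ 2 / 2) * x ^ 2)) :=
    (integrable_exp_neg_mul_sq (by positivity)).const_mul _
  refine hg.mono' ((measurable_comb hε).pow_const 2).aestronglyMeasurable
    (Filter.Eventually.of_forall fun x => ?_)
  have hr := abs_sub_round x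
  set r : ℝ := (round x : ℝ) with hrdef
  have hr2 : (x - r) ^ 2 ≤ 1 / 4 := by
    have := sq_le_sq' (by linarith [abs_nonneg (x - r)]) hr
    rw [sq_abs] at this; linarith
  have hkey : x ^ 2 / 2 - 1 / 4 ≤ r ^ 2 := by nlinarith [sq_nonneg (x - 2 * r)]
  rw [Real.norm_of_nonneg (sq_nonneg _), comb_eq hε, mul_pow, mul_pow]
  have h1 : envelope κ r ^ 2 ≤
      c ^ 2 * (Real.exp (κ ^ 2 / 4) * Real.exp (-(κ ^ 2 / 2) * x ^ 2)) := by
    unfold envelope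
    rw [← hc, mul_pow, ← Real.exp_nat_mul, ← Real.exp_add]
    gcongr
    push_cast
    nlinarith [mul_le_mul_of_nonneg_left hkey (sq_nonneg κ)]
  have h2 : truncPeak Δ ε (x - r) ^ 2 ≤ B ^ 2 :=
    pow_le_pow_left₀ (truncPeak_nonneg hΔ _ _) (hle _) 2
  calc _ ≤ c ^ 2 * (Real.exp (κ ^ 2 / 4) * Real.exp (-(κ ^ 2 / 2) * x ^ 2)) * B ^ 2 :=
        mul_le_mul h1 h2 (sq_nonneg _) (by positivity)
    _ = _ := by ring

theorem integral_comb_sq_pos {κ Δ ε : ℝ} (hκ : 0 < κ) (hΔ : 0 < Δ) (hε0 : 0 < ε)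
    (hε : ε < 1 / 2) : 0 < ∫ x, comb κ Δ ε x ^ 2 := by
  rw [integral_pos_iff_support_of_nonneg (fun x => sq_nonneg _) (integrable_comb_sq hκ hΔ hε)]
  refine lt_of_lt_of_le (b := volume (Set.Ioo (-ε) ε)) ?_ (measure_mono fun x hx => ?_)
  · simp [Real.volume_Ioo]; linarith
  · have hx' : |x| < ε := abs_lt.2 hx
    have h0 : round x = 0 := by
      rw [round_eq_zero_iff]
      exact ⟨by linarith [hx.1], by linarith [hx.2]⟩
    have : 0 < comb κ Δ ε x := by
      rw [comb_eq hε, h0]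
      refine mul_pos ?_ (truncPeak_pos hΔ hε0 (by simpa using hx'.le))
      unfold envelope; positivity
    exact (pow_pos this 2).ne'

theorem measurable_gkpInt {κ Δ ε : ℝ} (hε : ε < 1 / 2) : Measurable (gkpInt κ Δ ε) :=
  (measurable_comb hε).const_mul _

theorem integrable_gkpInt_sq {κ Δ ε : ℝ} (hκ : 0 < κ) (hΔ : 0 < Δ) (hε : ε < 1 / 2) :
    Integrable (fun x => gkpInt κ Δ ε x ^ 2) := by
  simp only [gkpInt, normalize, mul_pow]
  exact (integrable_comb_sq hκ hΔ hε).const_mul _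

theorem integral_gkpInt_sq {κ Δ ε : ℝ} (hκ : 0 < κ) (hΔ : 0 < Δ) (hε0 : 0 < ε)
    (hε : ε < 1 / 2) : ∫ x, gkpInt κ Δ ε x ^ 2 = 1 := by
  have h := integral_comb_sq_pos hκ hΔ hε0 hε
  simp only [gkpInt, normalize, mul_pow]
  rw [integral_const_mul, l2norm, inv_pow, Real.sq_sqrt h.le]
  exact inv_mul_cancel₀ h.ne'

theorem gkpInt_eq_zero {κ Δ ε x : ℝ} (hε : ε < 1 / 2) (hx : ε < |x - round x|) :
    gkpInt κ Δ ε x = 0 := by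
  simp [gkpInt, normalize, comb_eq hε, truncPeak_of_abs_gt hx]

theorem measurable_gkpFun {κ Δ ε : ℝ} (hε : ε < 1 / 2) (d j : ℕ) :
    Measurable (gkpFun κ Δ ε d j) := by
  have := measurable_gkpInt (κ := κ) (Δ := Δ) hε
  unfold gkpFun displace squeeze
  fun_prop

theorem gkpFun_sq (κ Δ ε : ℝ) (d : ℕ) (j : ℕ) (x : ℝ) :
    gkpFun κ Δ ε d j x ^ 2 = (√(2 * Real.pi * d))⁻¹ *
      gkpInt κ Δ ε ((x - j * √(2 * Real.pi / d)) / √(2 * Real.pi * d)) ^ 2 := by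
  simp only [gkpFun, displace, squeeze, mul_pow, one_div, inv_pow]
  rw [Real.sq_sqrt (Real.sqrt_nonneg _)]

theorem integrable_gkpFun_sq {κ Δ ε : ℝ} (hκ : 0 < κ) (hΔ : 0 < Δ) (hε : ε < 1 / 2) {d : ℕ}
    (hd : 0 < d) (j : ℕ) : Integrable (fun x => gkpFun κ Δ ε d j x ^ 2) := by
  have hα : √(2 * Real.pi * d) ≠ 0 := by positivity
  simp only [gkpFun_sq κ Δ ε d]
  exact (((integrable_gkpInt_sq hκ hΔ hε).comp_div hα).comp_sub_right _).const_mul _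

theorem integral_gkpFun_sq {κ Δ ε : ℝ} (hκ : 0 < κ) (hΔ : 0 < Δ) (hε0 : 0 < ε) (hε : ε < 1 / 2)
    {d : ℕ} (hd : 0 < d) (j : ℕ) : ∫ x, gkpFun κ Δ ε d j x ^ 2 = 1 := by
  have hα : 0 < √(2 * Real.pi * d) := by positivity
  simp only [gkpFun_sq κ Δ ε d]
  rw [integral_const_mul,
    integral_sub_right_eq_self (fun x => gkpInt κ Δ ε (x / √(2 * Real.pi * d)) ^ 2),
    Measure.integral_comp_div (fun x => gkpInt κ Δ ε x ^ 2), integral_gkpInt_sq hκ hΔ hε0 hε,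
    abs_of_pos hα, smul_eq_mul, mul_one, inv_mul_cancel₀ hα.ne']

theorem memLp_gkpFun {κ Δ ε : ℝ} (hκ : 0 < κ) (hΔ : 0 < Δ) (hε : ε < 1 / 2) {d : ℕ}
    (hd : 0 < d) (j : ℕ) : MemLp (fun x => (gkpFun κ Δ ε d j x : ℂ)) 2 volume := by
  have h : MemLp (gkpFun κ Δ ε d j) 2 volume :=
    (memLp_two_iff_integrable_sq (measurable_gkpFun hε d j).aestronglyMeasurable).2
      (integrable_gkpFun_sq hκ hΔ hε hd j)
  exact h.ofReal

/-- Distinct code states have essentially disjoint supports. -/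
theorem gkpFun_mul_ae_eq_zero (κ Δ : ℝ) {ε : ℝ} {d : ℕ} (hε : ε < 1 / 2)
    (hεd : ε ≤ 1 / (2 * d)) {j k : ℕ} (hk : k < d) (hjk : j < k) :
    ∀ᵐ x, gkpFun κ Δ ε d j x * gkpFun κ Δ ε d k x = 0 := by
  have hd : 0 < d := by omega
  have hdR : (0 : ℝ) < d := by exact_mod_cast hd
  set α := √(2 * Real.pi * d) with hα
  have hα0 : 0 < α := by positivity
  have hshift : √(2 * Real.pi / d) = α / d := by
    rw [hα, eq_div_iff hdR.ne']
    nth_rewrite 2 [← Real.sqrt_sq hdR.le]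
    rw [← Real.sqrt_mul (by positivity)]
    congr 1; field_simp
  have hcount : (Set.range fun m : ℤ => α * ((m : ℝ) + 1 / 2) / d).Countable :=
    Set.countable_range _
  filter_upwards [hcount.ae_notMem volume] with x hx
  have harg : ∀ i : ℕ, (x - i * √(2 * Real.pi / d)) / α = x / α - i / d := by
    intro i; rw [hshift]; field_simp
  by_contra hne
  obtain ⟨h1, h2⟩ := mul_ne_zero_iff.1 hne
  have key : ∀ i : ℕ, gkpFun κ Δ ε d i x ≠ 0 →
      |d * (x / α) - i - d * (round (x / α - i / d : ℝ) : ℝ)| ≤ 1 / 2 := by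
    intro i hi
    have h : ¬ ε < |x / α - i / d - round (x / α - i / d : ℝ)| := by
      intro h
      refine hi ?_
      simp only [gkpFun, displace, squeeze, ← hα, harg]
      rw [gkpInt_eq_zero hε h, mul_zero]
    have h' := (not_lt.1 h).trans hεd
    have : d * (x / α) - i - d * (round (x / α - i / d : ℝ) : ℝ) =
        d * (x / α - i / d - round (x / α - i / d : ℝ)) := by field_simp
    rw [this, abs_mul, abs_of_pos hdR]
    calc _ ≤ (d : ℝ) * (1 / (2 * d)) := by gcongr
      _ = 1 / 2 := by field_simp
  have hkj := key j h1
  have hkk := key k h2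
  set m := round (x / α - j / d : ℝ)
  set n := round (x / α - k / d : ℝ)
  have hne' : ∀ l : ℤ, (d : ℝ) * (x / α) ≠ l + 1 / 2 := by
    intro l hl
    refine hx ⟨l, ?_⟩
    simp only [← hl]
    field_simp
  -- strict bounds, since `d x / α` is not a half-integer
  have hj1 := abs_le.1 hkj
  have hk1 := abs_le.1 hkk
  have hsj : (d : ℝ) * (x / α) < j + d * m + 1 / 2 := by
    refine lt_of_le_of_ne (by linarith [hj1.2]) ?_
    have := hne' (j + d * m); push_cast at this; exact this
  have hsk : (d : ℝ) * (x / α) < k + d * n + 1 / 2 := by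
    refine lt_of_le_of_ne (by linarith [hk1.2]) ?_
    have := hne' (k + d * n); push_cast at this; exact this
  have e1 : (j + d * m : ℤ) < k + d * n + 1 := by
    have : ((j + d * m : ℤ) : ℝ) < ((k + d * n + 1 : ℤ) : ℝ) := by
      push_cast; linarith [hj1.1]
    exact_mod_cast this
  have e2 : (k + d * n : ℤ) < j + d * m + 1 := by
    have : ((k + d * n : ℤ) : ℝ) < ((j + d * m + 1 : ℤ) : ℝ) := by
      push_cast; linarith [hk1.1]
    exact_mod_cast this
  have e3 : ((k : ℤ) - j) = d * (m - n) := by linarith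
  have e4 : (d : ℤ) ∣ (k : ℤ) - j := ⟨_, e3⟩
  have := Int.le_of_dvd (by omega) e4
  omega

/-- The Hilbert space `L²(ℝ)` of one oscillator. -/
abbrev L2 : Type := Lp ℂ 2 (volume : Measure ℝ)

/-- The code state `GKP_{κ,Δ}^ε(j)_d` as an element of `L²(ℝ)`. -/
def gkpState {κ Δ ε : ℝ} (hκ : 0 < κ) (hΔ : 0 < Δ) (hε : ε < 1 / 2) {d : ℕ} (hd : 0 < d)
    (j : Fin d) : L2 :=
  (memLp_gkpFun hκ hΔ hε hd j).toLp (fun x => (gkpFun κ Δ ε d j x : ℂ))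

theorem inner_gkpState {κ Δ ε : ℝ} (hκ : 0 < κ) (hΔ : 0 < Δ) (hε : ε < 1 / 2) {d : ℕ}
    (hd : 0 < d) (j k : Fin d) :
    ⟪gkpState hκ hΔ hε hd j, gkpState hκ hΔ hε hd k⟫_ℂ =
      ((∫ x, gkpFun κ Δ ε d j x * gkpFun κ Δ ε d k x : ℝ) : ℂ) := by
  rw [MeasureTheory.L2.inner_def, ← integral_complex_ofReal]
  refine integral_congr_ae ?_
  filter_upwards [(memLp_gkpFun hκ hΔ hε hd j).coeFn_toLp,
    (memLp_gkpFun hκ hΔ hε hd k).coeFn_toLp] with x h1 h2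
  rw [gkpState, gkpState, h1, h2]
  simp [mul_comm]

theorem orthonormal_gkpState {κ Δ ε : ℝ} (hκ : 0 < κ) (hΔ : 0 < Δ) (hε0 : 0 < ε)
    (hε : ε < 1 / 2) {d : ℕ} (hd : 0 < d) (hεd : ε ≤ 1 / (2 * d)) :
    Orthonormal ℂ (gkpState hκ hΔ hε hd) := by
  rw [orthonormal_iff_ite]
  intro j k
  rw [inner_gkpState]
  rcases lt_trichotomy (j : ℕ) k with h | h | h
  · rw [if_neg (fun e => by simp [e] at h),
      integral_eq_zero_of_ae (gkpFun_mul_ae_eq_zero κ Δ hε hεd k.2 h), Complex.ofReal_zero]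
  · obtain rfl := Fin.ext h
    simp only [← pow_two, integral_gkpFun_sq hκ hΔ hε0 hε hd, if_true, Complex.ofReal_one]
  · rw [if_neg (fun e => by simp [e] at h)]
    simp only [mul_comm (gkpFun κ Δ ε d j _)]
    rw [integral_eq_zero_of_ae (gkpFun_mul_ae_eq_zero κ Δ hε hεd j.2 h), Complex.ofReal_zero]

/-- The isometric encoding map `ℂᵈ → L²(ℝ)`, `|j⟩ ↦ GKP_{κ,Δ}^ε(j)_d`. Its range is the code
`𝓛_{κ,Δ}^ε[d]`. -/
def gkpEncoder {κ Δ ε : ℝ} (hκ : 0 < κ) (hΔ : 0 < Δ) (hε0 : 0 < ε)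
    (hε : ε < 1 / 2) {d : ℕ} (hd : 0 < d) (hεd : ε ≤ 1 / (2 * d)) :
    EuclideanSpace ℂ (Fin d) →ₗᵢ[ℂ] L2 :=
  ((EuclideanSpace.basisFun (Fin d) ℂ).toBasis.constr ℂ
    (gkpState hκ hΔ hε hd)).isometryOfOrthonormal
    (v := (EuclideanSpace.basisFun (Fin d) ℂ).toBasis)
    (by simp [(EuclideanSpace.basisFun (Fin d) ℂ).orthonormal])
    (by
      have : (⇑((EuclideanSpace.basisFun (Fin d) ℂ).toBasis.constr ℂ (gkpState hκ hΔ hε hd)) ∘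
          ⇑(EuclideanSpace.basisFun (Fin d) ℂ).toBasis) = gkpState hκ hΔ hε hd := by
        ext1 j; simp only [Function.comp_apply, Module.Basis.constr_basis]
      rw [this]
      exact orthonormal_gkpState hκ hΔ hε0 hε hd hεd)

theorem gkpEncoder_single {κ Δ ε : ℝ} (hκ : 0 < κ) (hΔ : 0 < Δ) (hε0 : 0 < ε)
    (hε : ε < 1 / 2) {d : ℕ} (hd : 0 < d) (hεd : ε ≤ 1 / (2 * d)) (j : Fin d) :
    gkpEncoder hκ hΔ hε0 hε hd hεd (EuclideanSpace.single j 1) = gkpState hκ hΔ hε hd j := by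
  have : EuclideanSpace.single j (1 : ℂ) = (EuclideanSpace.basisFun (Fin d) ℂ).toBasis j := by
    simp
  rw [this]
  exact Module.Basis.constr_basis _ _ _ _

theorem memLp_phase_mul {φ : ℝ → ℝ} (hφ : Measurable φ) (ψ : L2) :
    MemLp (fun x => Complex.exp (Complex.I * φ x) * ψ x) 2 volume :=
  (Lp.memLp ψ).of_le (by fun_prop) (Filter.Eventually.of_forall fun x => by
    rw [norm_mul, mul_comm Complex.I, Complex.norm_exp_ofReal_mul_I, one_mul])

/-- Multiplication by the function `x ↦ e^{iφ(x)}` as an isometry of `L²(ℝ)`. -/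
def phaseMul (φ : ℝ → ℝ) (hφ : Measurable φ) : L2 →ₗᵢ[ℂ] L2 where
  toFun ψ := (memLp_phase_mul hφ ψ).toLp (fun x => Complex.exp (Complex.I * φ x) * ψ x)
  map_add' ψ χ := by
    rw [← MemLp.toLp_add]
    refine MemLp.toLp_congr _ _ ?_
    filter_upwards [Lp.coeFn_add ψ χ] with x hx
    rw [Pi.add_apply, hx, Pi.add_apply, mul_add]
  map_smul' c ψ := by
    rw [RingHom.id_apply, ← MemLp.toLp_const_smul]
    refine MemLp.toLp_congr _ _ ?_
    filter_upwards [Lp.coeFn_smul c ψ] with x hx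
    rw [Pi.smul_apply, hx, Pi.smul_apply, smul_eq_mul, smul_eq_mul, mul_left_comm]
  norm_map' ψ := by
    rw [LinearMap.coe_mk, AddHom.coe_mk, Lp.norm_toLp, Lp.norm_def]
    congr 1
    refine eLpNorm_congr_norm_ae (Filter.Eventually.of_forall fun x => ?_)
    rw [norm_mul, mul_comm Complex.I, Complex.norm_exp_ofReal_mul_I, one_mul]

theorem coeFn_phaseMul {φ : ℝ → ℝ} (hφ : Measurable φ) (ψ : L2) :
    phaseMul φ hφ ψ =ᵐ[volume] fun x => Complex.exp (Complex.I * φ x) * ψ x :=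
  MemLp.coeFn_toLp (memLp_phase_mul hφ ψ)

theorem phaseMul_phaseMul_neg {φ χ : ℝ → ℝ} (hφ : Measurable φ) (hχ : Measurable χ)
    (h : ∀ x, φ x + χ x = 0) (ψ : L2) : phaseMul φ hφ (phaseMul χ hχ ψ) = ψ := by
  refine Lp.ext ?_
  filter_upwards [coeFn_phaseMul hφ (phaseMul χ hχ ψ), coeFn_phaseMul hχ ψ] with x h1 h2
  rw [h1, h2, ← mul_assoc, ← Complex.exp_add, ← mul_add, ← Complex.ofReal_add, h x]
  simp

/-- The unitary `e^{iφ(Q)}` on `L²(ℝ)`: multiplication by `x ↦ e^{iφ(x)}`. -/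
def phaseUnitary (φ : ℝ → ℝ) (hφ : Measurable φ) : L2 ≃ₗᵢ[ℂ] L2 where
  toLinearEquiv := LinearEquiv.ofLinearMap (phaseMul φ hφ).toLinearMap
    (phaseMul (fun x => -φ x) hφ.neg).toLinearMap
    (by ext1 ψ; exact phaseMul_phaseMul_neg hφ hφ.neg (fun x => add_neg_cancel _) ψ)
    (by ext1 ψ; exact phaseMul_phaseMul_neg hφ.neg hφ (fun x => neg_add_cancel _) ψ)
  norm_map' ψ := (phaseMul φ hφ).norm_map ψ

/-- The Gaussian unitary `W_P = e^{i(Q² + c_d √(2π/d) Q)/2}`, where `c_d = d mod 2`. -/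
def phaseGateUnitary (d : ℕ) : L2 ≃ₗᵢ[ℂ] L2 :=
  phaseUnitary (fun x => (x ^ 2 + (d % 2 : ℕ) * √(2 * Real.pi / d) * x) / 2) (by fun_prop)

/-- The phase gate `P|x⟩ = e^{iπx(x + c_d)/d}|x⟩`, where `c_d = d mod 2`. -/
def phaseGate (d : ℕ) : Matrix.unitaryGroup (Fin d) ℂ :=
  ⟨Matrix.diagonal fun x : Fin d =>
    Complex.exp (Complex.I * Real.pi * ((x : ℕ) * ((x : ℕ) + (d % 2 : ℕ)) : ℂ) / d), by
    rw [Matrix.mem_unitaryGroup_iff, Matrix.star_eq_conjTranspose, Matrix.diagonal_conjTranspose,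
      Matrix.diagonal_mul_diagonal, ← Matrix.diagonal_one]
    congr 1
    ext x
    rw [Pi.star_apply, Complex.star_def, ← Complex.exp_conj, ← Complex.exp_add]
    simp [neg_div]⟩

theorem one_div_two_mul_lt {d : ℕ} (hd : 2 ≤ d) : 1 / (2 * (d : ℝ)) < 1 / 2 := by
  have : (2 : ℝ) ≤ d := by exact_mod_cast hd
  exact one_div_lt_one_div_of_lt (by norm_num) (by linarith)

theorem one_div_two_mul_pos {d : ℕ} (hd : 2 ≤ d) : 0 < 1 / (2 * (d : ℝ)) := by
  have : (2 : ℝ) ≤ d := by exact_mod_cast hd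
  positivity

/-- The encoding map of the code `𝓛_{κ,Δ}^⋆[d] = 𝓛_{κ,Δ}^{1/(2d)}[d]`. -/
def gkpStarEncoder (d : ℕ) (hd : 2 ≤ d) (κ Δ : ℝ) (hκ : 0 < κ) (hΔ : 0 < Δ) :
    EuclideanSpace ℂ (Fin d) →ₗᵢ[ℂ] L2 :=
  gkpEncoder (ε := 1 / (2 * (d : ℝ))) hκ hΔ (one_div_two_mul_pos hd) (one_div_two_mul_lt hd)
    (lt_of_lt_of_le two_pos hd) le_rfl

theorem swapped_kappa_pos {d : ℕ} (hd : 2 ≤ d) {Δ : ℝ} (hΔ : 0 < Δ) :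
    0 < 2 * Real.pi * d * Δ := by
  have : (2 : ℝ) ≤ d := by exact_mod_cast hd
  positivity

theorem swapped_delta_pos {d : ℕ} (hd : 2 ≤ d) {κ : ℝ} (hκ : 0 < κ) :
    0 < κ / (2 * Real.pi * d) := by
  have : (2 : ℝ) ≤ d := by exact_mod_cast hd
  positivity

end States

end GKP

end

noncomputable section

namespace GKP

/-! ### Lower bounds for the trace norm, the diamond norm and the gate error -/

section Channels

variable {H : Type*} [NormedAddCommGroup H] [InnerProductSpace ℂ H] [CompleteSpace H]

/-! The gate `P` fixes `|0⟩`, so an accurate implementation must return the encoded state `GKP(0)`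
to itself up to a phase. Testing the diamond norm on this pure state without an ancilla shows that
the error is at least `1 - |⟨GKP(0), W_P GKP(0)⟩|²` (`one_sub_sq_le_gateError`); it remains to keep
this overlap away from `1`.

In units where the peaks of `GKP(0)` sit at the integers, `W_P` multiplies by `exp(iπ(d y² + c_d
y))`. At `y = u + z` with `z ∈ ℤ` this is its value at `u` times `exp(2πi d u z)`, because `d z² +
c_d z` is even (`latticePhase_add_int`). Summing over the peaks with weights `η_κ(z)²` and applying
Poisson summation gives `∑ₙ exp(-(π/κ)² (n - d u)²)`. Truncation at `1/(2d)` forces `|d u| ≤ 1/2`,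
so for small `κ` only `n = 0` matters. The overlap is thus essentially bounded by the integral of
the peak density, proportional to `exp(-u²/Δ²)`, against `exp(-(π d u/κ)²)`. If `κ ≤ 2πdΔ`, the
second Gaussian is at most `exp(-u²/(4Δ²))`, and the integral is at most about `√(4/5)`
(`norm_integral_comb_sq_mul_latticePhase_le`).

The exchange `(κ, Δ) ↦ (2πdΔ, κ/(2πd))` reverses the inequality `κ ≤ 2πdΔ`, so at least one of the
two codes always satisfies it. -/

theorem norm_abs_apply (T : H →L[ℂ] H) (x : H) : ‖CFC.abs T x‖ = ‖T x‖ := by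
  have h1 : (CFC.abs T).adjoint = CFC.abs T := (CFC.abs_nonneg T).isSelfAdjoint.star_eq
  have h2 : CFC.abs T * CFC.abs T = star T * T := CFC.abs_mul_abs T
  have h3 : ⟪CFC.abs T x, CFC.abs T x⟫_ℂ = ⟪T x, T x⟫_ℂ := by
    rw [← ContinuousLinearMap.adjoint_inner_right, h1, ← ContinuousLinearMap.adjoint_inner_right,
      ← mul_apply_eq_comp, h2]
    rfl
  rw [inner_self_eq_norm_sq_to_K, inner_self_eq_norm_sq_to_K] at h3
  have h4 : ‖CFC.abs T x‖ ^ 2 = ‖T x‖ ^ 2 := by exact_mod_cast h3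
  exact (pow_left_inj₀ (norm_nonneg _) (norm_nonneg _) two_ne_zero).1 h4

/-- The trace norm dominates the operator norm. -/
theorem ofReal_norm_apply_le_traceNorm (T : H →L[ℂ] H) {x : H} (hx : ‖x‖ ≤ 1) :
    ENNReal.ofReal ‖T x‖ ≤ traceNorm T := by
  by_cases ht : traceNorm T = ∞
  · simp [ht]
  rw [← norm_abs_apply]
  set S := CFC.sqrt (CFC.abs T) with hS
  have h1 : S * S = CFC.abs T := CFC.sqrt_mul_sqrt_self _ (CFC.abs_nonneg T)
  -- A one-element orthonormal family in the supremum bounds `‖S y‖² = ⟨y, |T| y⟩`, hence `‖S‖²`,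
  -- and `|T| = S²`.
  have hunit : ∀ y : H, ‖y‖ = 1 → ‖S y‖ ^ 2 ≤ (traceNorm T).toReal := by
    intro y hy
    rw [← ENNReal.ofReal_le_iff_le_toReal ht, ← ofReal_re_inner_abs]
    have he : Orthonormal ℂ (fun _ : Fin 1 => y) := by
      rw [orthonormal_iff_ite]
      intro i j
      rw [Subsingleton.elim i j, inner_self_eq_norm_sq_to_K, hy]; simp
    refine le_trans ?_ (le_iSup_of_le 1 (le_iSup_of_le _ (le_iSup_of_le he le_rfl)))
    simp
  have hnorm : ‖S‖ ≤ √(traceNorm T).toReal := by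
    refine ContinuousLinearMap.opNorm_le_of_unit_norm (𝕜 := ℂ) (Real.sqrt_nonneg _) fun y hy => ?_
    exact Real.le_sqrt_of_sq_le (hunit y hy)
  rw [ENNReal.ofReal_le_iff_le_toReal ht, ← h1, mul_apply_eq_comp]
  calc ‖S (S x)‖ ≤ ‖S‖ * (‖S‖ * ‖x‖) :=
        (S.le_opNorm _).trans (mul_le_mul_of_nonneg_left (S.le_opNorm _) (norm_nonneg _))
    _ ≤ ‖S‖ * ‖S‖ := by
        gcongr
        exact mul_le_of_le_one_right (norm_nonneg _) hx
    _ ≤ √(traceNorm T).toReal * √(traceNorm T).toReal := by gcongr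
    _ = (traceNorm T).toReal := Real.mul_self_sqrt ENNReal.toReal_nonneg

theorem ofReal_norm_inner_le_traceNorm (T : H →L[ℂ] H) {x : H} (hx : ‖x‖ ≤ 1) :
    ENNReal.ofReal ‖⟪x, T x⟫_ℂ‖ ≤ traceNorm T := by
  refine (ENNReal.ofReal_le_ofReal ?_).trans (ofReal_norm_apply_le_traceNorm T hx)
  exact (norm_inner_le_norm _ _).trans (mul_le_of_le_one_left (norm_nonneg _) hx)

/-- A rank-one projection onto a unit vector has trace norm at most one. -/
theorem traceNorm_rankOne_self_le {x : H} (hx : ‖x‖ ≤ 1) :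
    traceNorm (InnerProductSpace.rankOne ℂ x x) ≤ 1 := by
  have hpos : 0 ≤ InnerProductSpace.rankOne ℂ x x := by
    rw [ContinuousLinearMap.nonneg_iff_isPositive]
    exact InnerProductSpace.isPositive_rankOne_self x
  refine iSup_le fun n => iSup_le fun e => iSup_le fun he => ?_
  rw [CFC.abs_of_nonneg _ hpos]
  have h : ∀ i, RCLike.re ⟪e i, InnerProductSpace.rankOne ℂ x x (e i)⟫_ℂ = ‖⟪e i, x⟫_ℂ‖ ^ 2 := by
    intro i
    rw [InnerProductSpace.rankOne_apply, inner_smul_right, inner_mul_symm_re_eq_norm, norm_mul,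
      norm_inner_symm, sq]
  simp only [h]
  rw [← ENNReal.ofReal_sum_of_nonneg fun _ _ => sq_nonneg _, ← ENNReal.ofReal_one]
  refine ENNReal.ofReal_le_ofReal ?_
  refine (he.sum_inner_products_le x (s := Finset.univ)).trans ?_
  exact pow_le_one₀ (norm_nonneg _) hx

theorem conjMap_apply {K : Type*} [NormedAddCommGroup K] [InnerProductSpace ℂ K] [CompleteSpace K]
    (A : H →L[ℂ] K) (X : H →L[ℂ] H) : conjMap A X = A ∘L X ∘L A.adjoint := rfl

theorem conjMap_rankOne {K : Type*} [NormedAddCommGroup K] [InnerProductSpace ℂ K]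
    [CompleteSpace K] (A : H →L[ℂ] K) (x y : H) :
    conjMap A (InnerProductSpace.rankOne ℂ x y) = InnerProductSpace.rankOne ℂ (A x) (A y) := by
  ext z
  simp [conjMap_apply, ContinuousLinearMap.adjoint_inner_right]

/-- The diamond norm dominates the trace norm of the image of a pure state. -/
theorem ofReal_norm_inner_le_diamondNorm (E : (H →L[ℂ] H) →ₗ[ℂ] (H →L[ℂ] H)) {x y : H}
    (hx : ‖x‖ ≤ 1) (hy : ‖y‖ ≤ 1) :
    ENNReal.ofReal ‖⟪y, E (InnerProductSpace.rankOne ℂ x x) y⟫_ℂ‖ ≤ diamondNorm E := by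
  -- The ancilla dimension `n = 1` suffices: there the coordinate map identifies `H ⊗ ℂ¹` with `H`,
  -- and the amplification is `E` itself up to this identification.
  have hcoord : ∀ z : H, coord 1 0 ((coord 1 0).adjoint z) = z := by
    intro z
    refine ext_inner_right ℂ fun w => ?_
    have hw : w = coord 1 0 (WithLp.toLp 2 fun _ : Fin 1 => w) := rfl
    conv_rhs => rw [hw, ← ContinuousLinearMap.adjoint_inner_left]
    rw [PiLp.inner_apply]
    simp [coord]
  have hnorm : ∀ z : H, ‖(coord 1 0).adjoint z‖ = ‖z‖ := by
    intro z
    have h : ⟪(coord 1 0).adjoint z, (coord 1 0).adjoint z⟫_ℂ = ⟪z, z⟫_ℂ := by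
      rw [ContinuousLinearMap.adjoint_inner_left, hcoord]
    rw [inner_self_eq_norm_sq_to_K, inner_self_eq_norm_sq_to_K] at h
    have h4 : ‖(coord 1 0).adjoint z‖ ^ 2 = ‖z‖ ^ 2 := by exact_mod_cast h
    exact (pow_left_inj₀ (norm_nonneg _) (norm_nonneg _) two_ne_zero).1 h4
  set X := InnerProductSpace.rankOne ℂ ((coord 1 0).adjoint x) ((coord 1 0).adjoint x) with hX
  refine le_trans ?_ (le_iSup_of_le 1 (le_iSup_of_le X
    (le_iSup_of_le (traceNorm_rankOne_self_le ((hnorm x).trans_le hx)) le_rfl)))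
  have hle := ofReal_norm_inner_le_traceNorm (ampliation 1 E X) (x := (coord 1 0).adjoint y)
    (by rw [hnorm]; exact hy)
  refine le_trans (le_of_eq ?_) hle
  have hXc : (coord 1 0 : Copies 1 H →L[ℂ] H) ∘L X ∘L (coord 1 0).adjoint =
      InnerProductSpace.rankOne ℂ x x := by
    have h := conjMap_rankOne (coord 1 0 : Copies 1 H →L[ℂ] H) ((coord 1 0).adjoint x)
      ((coord 1 0).adjoint x)
    rw [hcoord] at h
    exact h
  simp only [ampliation, Finset.univ_unique, Fin.default_eq_zero, Fin.isValue,
    Finset.sum_singleton, hXc, ContinuousLinearMap.comp_apply,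
    ContinuousLinearMap.adjoint_inner_left, hcoord]

variable {d : ℕ} (enc : EuclideanSpace ℂ (Fin d) →ₗᵢ[ℂ] H)

/-- A logical basis state fixed by the gate bounds the gate error from below through its overlap
with its image under the implementation. -/
theorem one_sub_sq_le_gateError (W : H ≃ₗᵢ[ℂ] H) (U : Matrix.unitaryGroup (Fin d) ℂ)
    {v : EuclideanSpace ℂ (Fin d)} (hv : ‖v‖ = 1)
    (hU : Matrix.toEuclideanCLM (𝕜 := ℂ) (U : Matrix (Fin d) (Fin d) ℂ) v = v) :
    ENNReal.ofReal (1 - ‖⟪enc v, W (enc v)⟫_ℂ‖ ^ 2) ≤ gateError enc W U := by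
  set x := enc v with hx
  have hx1 : ‖x‖ = 1 := by rw [hx, enc.norm_map, hv]
  -- The input state and the test vector are the same `x`: the expectation of `|Wx⟩⟨Wx| - |x⟩⟨x|` in
  -- `x` is `|⟨x, Wx⟩|² - 1`.
  refine le_trans (ENNReal.ofReal_le_ofReal ?_)
    (ofReal_norm_inner_le_diamondNorm _ (x := x) (y := x) hx1.le hx1.le)
  have hproj : (codeSpace enc).orthogonalProjectionOnto x = encodeIso enc v := by
    have : x = ((encodeIso enc v : codeSpace enc) : H) := rfl
    rw [this, Submodule.orthogonalProjectionOnto_mem_subspace_eq_self]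
  have hgate : encodedGate enc U (encodeIso enc v) = encodeIso enc v := by
    simp [encodedGate, hU]
  have hcoe : ((encodeIso enc v : codeSpace enc) : H) = x := rfl
  simp only [LinearMap.comp_apply, LinearMap.sub_apply, conjMap_rankOne, hproj, hgate,
    Submodule.subtypeL_apply, hcoe, sub_apply, inner_sub_right,
    InnerProductSpace.rankOne_apply, inner_smul_right]
  have hW : W.toContinuousLinearEquiv.toContinuousLinearMap x = W x := rfl
  rw [hW, inner_self_eq_norm_sq_to_K, hx1, ← inner_conj_symm, Complex.mul_conj', norm_sub_rev]
  refine le_trans ?_ (RCLike.re_le_norm _)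
  rw [RCLike.norm_conj]
  simp [← Complex.ofReal_pow]

end Channels

/-! ### Poisson summation and Gaussian lattice sums -/

section Overlap

theorem envelope_sq {κ : ℝ} (hκ : 0 < κ) (x : ℝ) :
    envelope κ x ^ 2 = κ / √Real.pi * Real.exp (-κ ^ 2 * x ^ 2) := by
  have h : (Real.pi ^ (1 / 4 : ℝ)) ^ 2 = √Real.pi := by
    rw [← Real.rpow_natCast, ← Real.rpow_mul Real.pi_pos.le, Real.sqrt_eq_rpow]
    norm_num
  rw [envelope, mul_pow, div_pow, Real.sq_sqrt hκ.le, h, ← Real.exp_nat_mul]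
  congr 2
  push_cast
  ring

/-- Poisson summation for the squared envelope. -/
theorem tsum_envelope_sq_mul_exp {κ : ℝ} (hκ : 0 < κ) (s : ℝ) :
    ∑' z : ℤ, ((envelope κ z ^ 2 : ℝ) : ℂ) * Complex.exp (2 * Real.pi * Complex.I * s * z) =
      ((∑' n : ℤ, Real.exp (-(Real.pi ^ 2 / κ ^ 2) * (n - s) ^ 2) : ℝ) : ℂ) := by
  have hπ := Real.pi_pos
  have hπ' : (Real.pi : ℂ) ≠ 0 := by exact_mod_cast hπ.ne'
  have hκ' : (κ : ℂ) ≠ 0 := by exact_mod_cast hκ.ne'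
  have ha : 0 < (((κ ^ 2 / Real.pi : ℝ) : ℂ)).re := by
    rw [Complex.ofReal_re]; positivity
  -- With `a = κ²/π` and `b = is`, the quadratic term is `-κ² z²` and the linear one is the
  -- character `exp(2πi s z)`. On the dual side `n + ib = n - s`, and the prefactor `√π/κ` cancels
  -- the normalization of the squared envelope.
  have h := Complex.tsum_exp_neg_quadratic ha (Complex.I * s)
  have hroot : ((κ ^ 2 / Real.pi : ℝ) : ℂ) ^ (1 / 2 : ℂ) = ((κ / √Real.pi : ℝ) : ℂ) := by
    have : (1 / 2 : ℂ) = ((1 / 2 : ℝ) : ℂ) := by norm_num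
    rw [this, ← Complex.ofReal_cpow (by positivity), ← Real.sqrt_eq_rpow,
      Real.sqrt_div' _ hπ.le, Real.sqrt_sq hκ.le]
  rw [hroot] at h
  have hleft : ∀ z : ℤ, ((envelope κ z ^ 2 : ℝ) : ℂ) *
      Complex.exp (2 * Real.pi * Complex.I * s * z) = ((κ / √Real.pi : ℝ) : ℂ) *
        Complex.exp (-Real.pi * ((κ ^ 2 / Real.pi : ℝ) : ℂ) * z ^ 2 +
          2 * Real.pi * (Complex.I * s) * z) := by
    intro z
    rw [envelope_sq hκ, Complex.ofReal_mul, Complex.ofReal_exp, mul_assoc, ← Complex.exp_add]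
    congr 2
    push_cast
    field_simp
  have hc : ((κ / √Real.pi : ℝ) : ℂ) ≠ 0 := by
    rw [Complex.ofReal_ne_zero]; positivity
  simp only [hleft]
  rw [tsum_mul_left, h, ← mul_assoc, mul_one_div_cancel hc, one_mul, Complex.ofReal_tsum]
  refine tsum_congr fun n => ?_
  rw [Complex.ofReal_exp]
  congr 1
  push_cast
  rw [← mul_assoc Complex.I, Complex.I_mul_I]
  field_simp
  ring

theorem hasSum_pow_natAbs {q : ℝ} (hq0 : 0 ≤ q) (hq1 : q < 1) :
    HasSum (fun n : ℤ => q ^ n.natAbs) ((1 - q)⁻¹ + q * (1 - q)⁻¹) := by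
  have h := hasSum_geometric_of_lt_one hq0 hq1
  refine HasSum.of_nat_of_neg_add_one (by simpa using h) ?_
  have hn : ∀ n : ℕ, (-((n : ℤ) + 1)).natAbs = n + 1 := fun n => by omega
  simpa only [hn, pow_succ'] using h.mul_left q

/-- Since `|s| ≤ 1/2 ≤ |n|/2`, one has `|n - s| ≥ |n|/2`, and `n² ≥ |n|` makes the Gaussian tail
geometric. -/
theorem exp_neg_mul_sub_sq_le {A s : ℝ} (hA : 0 ≤ A) (hs : |s| ≤ 1 / 2) {n : ℤ} (hn : n ≠ 0) :
    Real.exp (-A * (n - s) ^ 2) ≤ Real.exp (-(A / 4)) ^ n.natAbs := by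
  rw [← Real.exp_nat_mul, Real.exp_le_exp]
  have h1 : (1 : ℝ) ≤ |(n : ℝ)| := by exact_mod_cast Int.one_le_abs hn
  have h2 : (n.natAbs : ℝ) = |(n : ℝ)| := by
    rw [Nat.cast_natAbs, Int.cast_abs]
  rw [h2]
  have h3 : |(n : ℝ)| / 2 ≤ |(n : ℝ) - s| := by
    have := abs_sub_abs_le_abs_sub (n : ℝ) s
    linarith
  have h4 : |(n : ℝ)| / 4 ≤ ((n : ℝ) - s) ^ 2 := by
    rw [← sq_abs]
    nlinarith
  nlinarith [mul_le_mul_of_nonneg_left h4 hA]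

theorem summable_exp_neg_mul_sub_sq {A s : ℝ} (hA : 0 < A) (hs : |s| ≤ 1 / 2) :
    Summable fun n : ℤ => Real.exp (-A * (n - s) ^ 2) := by
  have hq : Real.exp (-(A / 4)) < 1 := Real.exp_lt_one_iff.2 (by linarith)
  refine ((hasSum_pow_natAbs (Real.exp_pos _).le hq).summable).of_nonneg_of_le
    (fun n => (Real.exp_pos _).le) fun n => ?_
  by_cases hn : n = 0
  · subst hn
    simp only [Int.natAbs_zero, pow_zero]
    exact Real.exp_le_one_iff.2 (by nlinarith [sq_nonneg (((0 : ℤ) : ℝ) - s)])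
  · exact exp_neg_mul_sub_sq_le hA.le hs hn

/-- A narrow periodized Gaussian is close to its central term on a fundamental domain. -/
theorem tsum_exp_neg_mul_sub_sq_le {A s : ℝ} (hA : 900 ≤ A) (hs : |s| ≤ 1 / 2) :
    ∑' n : ℤ, Real.exp (-A * (n - s) ^ 2) ≤ Real.exp (-A * s ^ 2) + 1 / 100 := by
  set q := Real.exp (-(A / 4)) with hq
  have hq0 : 0 < q := Real.exp_pos _
  -- Here `226 = 900/4 + 1`, from `exp x ≥ x + 1`.
  have hq226 : q ≤ 1 / 226 := by
    rw [hq, Real.exp_neg, inv_eq_one_div]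
    exact one_div_le_one_div_of_le (by norm_num) (by linarith [Real.add_one_le_exp (A / 4)])
  -- The geometric majorant, with its term `1` at `n = 0` replaced by the exact central term. The
  -- remaining terms sum to `2q/(1 - q) ≤ 2/225 < 1/100`.
  have hsum := (hasSum_pow_natAbs hq0.le (by linarith : q < 1)).add
    (hasSum_ite_eq (0 : ℤ) (Real.exp (-A * s ^ 2) - 1))
  refine (Summable.tsum_le_tsum (fun n => ?_) (summable_exp_neg_mul_sub_sq (by linarith) hs)
    hsum.summable).trans ?_
  · by_cases hn : n = 0
    · subst hn; simp
    · simpa [hn] using exp_neg_mul_sub_sq_le (by linarith) hs hn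
  · rw [hsum.tsum_eq]
    have h : (1 - q)⁻¹ ≤ 226 / 225 := by
      rw [inv_le_comm₀ (by linarith) (by norm_num)]
      linarith
    have h' : q * (1 - q)⁻¹ ≤ 1 / 226 * (226 / 225) :=
      mul_le_mul hq226 h (inv_nonneg.2 (by linarith)) (by norm_num)
    linarith

theorem one_le_tsum_exp_neg_mul_sq {A : ℝ} (hA : 0 < A) :
    1 ≤ ∑' n : ℤ, Real.exp (-A * (n - 0) ^ 2) := by
  have h := (summable_exp_neg_mul_sub_sq hA (s := 0) (by simp)).le_tsum 0
    (fun n _ => (Real.exp_pos _).le)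
  simpa using h

theorem summable_envelope_sq {κ : ℝ} (hκ : 0 < κ) : Summable fun z : ℤ => envelope κ z ^ 2 := by
  simp only [envelope_sq hκ]
  have h := summable_exp_neg_mul_sub_sq (A := κ ^ 2) (s := 0) (by positivity) (by simp)
  simpa only [sub_zero] using h.mul_left (κ / √Real.pi)

/-- Poisson summation at `s = 0`: the dual sum is positive with central term `1`. This sum is the
squared norm of the unnormalized comb, so dividing by it cannot increase the overlap. -/
theorem one_le_tsum_envelope_sq {κ : ℝ} (hκ : 0 < κ) : 1 ≤ ∑' z : ℤ, envelope κ z ^ 2 := by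
  have h := tsum_envelope_sq_mul_exp hκ 0
  simp only [Complex.ofReal_zero, mul_zero, zero_mul, Complex.exp_zero, mul_one] at h
  rw [← Complex.ofReal_tsum, Complex.ofReal_inj] at h
  rw [h]
  exact one_le_tsum_exp_neg_mul_sq (by have := Real.pi_pos; positivity)

/-! ### Decomposition of the comb into its peaks -/

theorem l2norm_truncated_peak_pos {Δ ε : ℝ} (hΔ : 0 < Δ) (hε : 0 < ε) :
    0 < l2norm ((Set.Icc (-ε) ε).indicator (peak Δ)) := by
  have h := truncPeak_pos hΔ hε (x := 0) (by simpa using hε.le)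
  refine (Real.sqrt_nonneg _).lt_of_ne fun h0 => ?_
  rw [truncPeak, normalize, l2norm, ← h0, inv_zero, zero_mul] at h
  exact h.false

theorem integral_truncPeak_sq {Δ ε : ℝ} (hΔ : 0 < Δ) (hε : 0 < ε) :
    ∫ x, truncPeak Δ ε x ^ 2 = 1 := by
  have h := l2norm_truncated_peak_pos hΔ hε
  have h' : l2norm ((Set.Icc (-ε) ε).indicator (peak Δ)) ^ 2 =
      ∫ x, (Set.Icc (-ε) ε).indicator (peak Δ) x ^ 2 :=
    Real.sq_sqrt (integral_nonneg fun _ => sq_nonneg _)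
  simp only [truncPeak, normalize, mul_pow]
  rw [integral_const_mul, ← h', inv_pow]
  exact inv_mul_cancel₀ (by positivity)

theorem integrable_truncPeak_sq {Δ ε : ℝ} (hΔ : 0 < Δ) (hε : 0 < ε) :
    Integrable fun x => truncPeak Δ ε x ^ 2 :=
  Integrable.of_integral_ne_zero (by rw [integral_truncPeak_sq hΔ hε]; exact one_ne_zero)

theorem comb_sq {κ Δ ε : ℝ} (hε : ε < 1 / 2) (x : ℝ) :
    HasSum (fun z : ℤ => envelope κ z ^ 2 * truncPeak Δ ε (x - z) ^ 2) (comb κ Δ ε x ^ 2) := by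
  rw [comb_eq hε, mul_pow]
  refine hasSum_single (round x) fun z hz => ?_
  rw [truncPeak_of_abs_gt, zero_pow two_ne_zero, mul_zero]
  have h1 : (1 : ℝ) ≤ |(z : ℝ) - round x| := by
    exact_mod_cast Int.one_le_abs (sub_ne_zero.2 hz)
  have h2 := abs_sub_round x
  have h3 := abs_sub_le (z : ℝ) x (round x)
  rw [abs_sub_comm (z : ℝ) x] at h3
  linarith

/-- Term-by-term integration of a bounded function against weighted peaks. -/
theorem hasSum_integral_envelope_mul {κ : ℝ} (hκ : 0 < κ) {g : ℤ → ℝ → ℝ}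
    (hg0 : ∀ z x, 0 ≤ g z x) (hg : ∀ z, Integrable (g z)) (hg1 : ∀ z, ∫ x, g z x = 1)
    {F : ℤ → ℝ → ℂ} (hF : ∀ z, Measurable (F z)) (hF1 : ∀ z x, ‖F z x‖ = 1) :
    HasSum (fun z : ℤ => ∫ x, ((envelope κ z ^ 2 * g z x : ℝ) : ℂ) * F z x)
      (∫ x, ∑' z : ℤ, ((envelope κ z ^ 2 * g z x : ℝ) : ℂ) * F z x) := by
  have hint : ∀ z : ℤ, Integrable fun x => ((envelope κ z ^ 2 * g z x : ℝ) : ℂ) * F z x := by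
    intro z
    exact (((hg z).const_mul _).ofReal).mul_bdd (c := 1) (hF z).aestronglyMeasurable
      (Filter.Eventually.of_forall fun x => (hF1 z x).le)
  refine hasSum_integral_of_summable_integral_norm hint ?_
  refine (summable_envelope_sq hκ).congr fun z => ?_
  have : ∀ x, ‖((envelope κ z ^ 2 * g z x : ℝ) : ℂ) * F z x‖ = envelope κ z ^ 2 * g z x := by
    intro x
    rw [norm_mul, hF1, mul_one, Complex.norm_real,
      Real.norm_of_nonneg (mul_nonneg (sq_nonneg _) (hg0 z x))]
  simp only [this]
  rw [integral_const_mul, hg1, mul_one]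

/-- The peaks have disjoint supports for `ε < 1/2`, so the squared comb has no cross terms; each
peak is then translated to the origin. Taking `F = 1` computes the normalization, taking the phase
of `W_P` the overlap. -/
theorem hasSum_integral_comb_sq_mul {κ Δ ε : ℝ} (hκ : 0 < κ) (hΔ : 0 < Δ) (hε0 : 0 < ε)
    (hε : ε < 1 / 2) {F : ℝ → ℂ} (hF : Measurable F) (hF1 : ∀ x, ‖F x‖ = 1) :
    HasSum (fun z : ℤ => ∫ u, ((envelope κ z ^ 2 * truncPeak Δ ε u ^ 2 : ℝ) : ℂ) * F (u + z))
      (∫ x, ((comb κ Δ ε x ^ 2 : ℝ) : ℂ) * F x) := by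
  have h := hasSum_integral_envelope_mul hκ (g := fun z x => truncPeak Δ ε (x - z) ^ 2)
    (fun _ _ => sq_nonneg _) (fun z => (integrable_truncPeak_sq hΔ hε0).comp_sub_right _)
    (fun z => by
      rw [integral_sub_right_eq_self (fun x => truncPeak Δ ε x ^ 2), integral_truncPeak_sq hΔ hε0])
    (F := fun _ => F) (fun _ => hF) (fun _ => hF1)
  convert h using 1
  · ext z
    rw [← integral_sub_right_eq_self _ (z : ℝ)]
    simp only [sub_add_cancel]
  · congr 1
    ext x
    rw [tsum_mul_right, ← Complex.ofReal_tsum, (comb_sq hε x).tsum_eq]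

theorem integral_comb_sq {κ Δ ε : ℝ} (hκ : 0 < κ) (hΔ : 0 < Δ) (hε0 : 0 < ε)
    (hε : ε < 1 / 2) : ∫ x, comb κ Δ ε x ^ 2 = ∑' z : ℤ, envelope κ z ^ 2 := by
  have h := hasSum_integral_comb_sq_mul hκ hΔ hε0 hε (F := fun _ => 1) measurable_const (by simp)
  simp only [mul_one, integral_complex_ofReal, integral_const_mul, integral_truncPeak_sq hΔ hε0] at h
  have h' := h.tsum_eq
  rw [← Complex.ofReal_tsum, Complex.ofReal_inj] at h'
  exact h'.symm

/-! ### The overlap integral in lattice units -/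

theorem dvd_two_phase (d : ℕ) (z : ℤ) : (2 : ℤ) ∣ d * z ^ 2 + (d % 2 : ℕ) * z := by
  rw [← even_iff_two_dvd]
  rcases Nat.even_or_odd d with h | h
  · rw [Nat.even_iff.1 h]
    simp [h]
  · rw [Nat.odd_iff.1 h]
    have : ¬ Even d := Nat.not_even_iff_odd.2 h
    simp only [Nat.cast_one, one_mul, Int.even_add, Int.even_mul, Int.even_pow]
    simp [this]

/-- The phase of `W_P` in units where the code states live on the lattice `ℤ`. -/
def latticePhase (d : ℕ) (y : ℝ) : ℂ :=
  Complex.exp (Complex.I * ((Real.pi * d * y ^ 2 + Real.pi * (d % 2 : ℕ) * y : ℝ) : ℂ))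

theorem norm_latticePhase (d : ℕ) (y : ℝ) : ‖latticePhase d y‖ = 1 := by
  rw [latticePhase, mul_comm Complex.I, Complex.norm_exp_ofReal_mul_I]

theorem measurable_latticePhase (d : ℕ) : Measurable (latticePhase d) := by
  unfold latticePhase; fun_prop

/-- Expanding the square leaves the cross term `2πduz` and the term `π(d z² + c_d z)`, which is a
multiple of `2π` by parity; this is the role of the correction `c_d`. -/
theorem latticePhase_add_int (d : ℕ) (u : ℝ) (z : ℤ) :
    latticePhase d (u + z) =
      latticePhase d u * Complex.exp (2 * Real.pi * Complex.I * (d * u : ℝ) * z) := by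
  obtain ⟨k, hk⟩ := dvd_two_phase d z
  have hk' : (d : ℂ) * z ^ 2 + (d % 2 : ℕ) * z = 2 * k := by
    generalize d % 2 = c at hk
    exact_mod_cast hk
  rw [latticePhase, latticePhase, ← Complex.exp_add, Complex.exp_eq_exp_iff_exists_int]
  refine ⟨k, ?_⟩
  push_cast
  linear_combination Complex.I * Real.pi * hk'

/-- Two evaluations of the same series of integrals: one reassembles the comb, the other sums over
the peaks at a fixed offset `u`, where Poisson summation applies with `s = d u`. -/
theorem integral_comb_sq_mul_latticePhase {κ Δ ε : ℝ} (hκ : 0 < κ) (hΔ : 0 < Δ) (hε0 : 0 < ε)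
    (hε : ε < 1 / 2) (d : ℕ) :
    ∫ x, ((comb κ Δ ε x ^ 2 : ℝ) : ℂ) * latticePhase d x =
      ∫ u, ((truncPeak Δ ε u ^ 2 *
        ∑' n : ℤ, Real.exp (-(Real.pi ^ 2 / κ ^ 2) * (n - d * u) ^ 2) : ℝ) : ℂ) *
          latticePhase d u := by
  have h1 := hasSum_integral_comb_sq_mul hκ hΔ hε0 hε (measurable_latticePhase d)
    (norm_latticePhase d)
  have h2 := hasSum_integral_envelope_mul hκ (g := fun _ x => truncPeak Δ ε x ^ 2)
    (fun _ _ => sq_nonneg _) (fun z => integrable_truncPeak_sq hΔ hε0)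
    (fun z => integral_truncPeak_sq hΔ hε0)
    (F := fun z u => latticePhase d (u + z))
    (fun z => (measurable_latticePhase d).comp (measurable_id.add_const _))
    (fun _ _ => norm_latticePhase d _)
  rw [h1.unique h2]
  congr 1
  ext u
  rw [Complex.ofReal_mul, ← tsum_envelope_sq_mul_exp hκ, ← tsum_mul_left, ← tsum_mul_right]
  refine tsum_congr fun z => ?_
  rw [latticePhase_add_int]
  push_cast
  ring

end Overlap

/-! ### Gaussian estimates and the bound on the overlap -/

section Bound

theorem peak_sq {Δ : ℝ} (hΔ : 0 < Δ) (x : ℝ) :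
    peak Δ x ^ 2 = 1 / (√Real.pi * Δ) * Real.exp (-(1 / Δ ^ 2) * x ^ 2) := by
  have h : (Real.pi ^ (1 / 4 : ℝ)) ^ 2 = √Real.pi := by
    rw [← Real.rpow_natCast, ← Real.rpow_mul Real.pi_pos.le, Real.sqrt_eq_rpow]
    norm_num
  rw [peak, mul_pow, div_pow, mul_pow, Real.sq_sqrt hΔ.le, h, ← Real.exp_nat_mul, one_pow]
  congr 2
  push_cast
  field_simp

/-- Used with `b = 1` for the peak density, `b = 1/2` for a majorant of its tail, and `b = 5/4` for
its product with `exp(-x²/(4Δ²))`. -/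
theorem integral_peak_normalized_gaussian {Δ b : ℝ} (hΔ : 0 < Δ) :
    ∫ x, 1 / (√Real.pi * Δ) * Real.exp (-(b / Δ ^ 2) * x ^ 2) = √(1 / b) := by
  have hπ := Real.pi_pos
  have h : Real.pi / (b / Δ ^ 2) = (1 / b) * (√Real.pi * Δ) ^ 2 := by
    rw [mul_pow, Real.sq_sqrt hπ.le]; field_simp
  rw [integral_const_mul, integral_gaussian, h, Real.sqrt_mul' _ (sq_nonneg _),
    Real.sqrt_sq (by positivity)]
  field_simp

theorem integrable_peak_normalized_gaussian {Δ b : ℝ} (hΔ : 0 < Δ) (hb : 0 < b) :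
    Integrable fun x => 1 / (√Real.pi * Δ) * Real.exp (-(b / Δ ^ 2) * x ^ 2) :=
  (integrable_exp_neg_mul_sq (by positivity)).const_mul _

theorem indicator_peak_sq_le (Δ ε x : ℝ) :
    (Set.Icc (-ε) ε).indicator (peak Δ) x ^ 2 ≤ peak Δ x ^ 2 := by
  by_cases h : x ∈ Set.Icc (-ε) ε
  · simp [h]
  · rw [Set.indicator_of_notMem h, zero_pow two_ne_zero]
    exact sq_nonneg _

/-- Truncating a peak at twenty times its width removes at most one percent of its mass. -/
theorem le_sq_l2norm_truncated_peak {Δ ε : ℝ} (hΔ : 0 < Δ) (hε : 20 * Δ ≤ ε) :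
    99 / 100 ≤ l2norm ((Set.Icc (-ε) ε).indicator (peak Δ)) ^ 2 := by
  rw [l2norm, Real.sq_sqrt (integral_nonneg fun _ => sq_nonneg _)]
  set f : ℝ → ℝ := fun x => (Set.Icc (-ε) ε).indicator (peak Δ) x ^ 2
  have hpeak : Integrable fun x => peak Δ x ^ 2 := by
    simp only [peak_sq hΔ]
    exact integrable_peak_normalized_gaussian hΔ one_pos
  have hf : Integrable f := hpeak.mono'
    (((continuous_peak Δ).measurable.indicator measurableSet_Icc).pow_const 2).aestronglyMeasurable
    (Filter.Eventually.of_forall fun x => by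
      rw [Real.norm_of_nonneg (sq_nonneg _)]; exact indicator_peak_sq_le Δ ε x)
  have htail := integrable_peak_normalized_gaussian (b := 1 / 2) hΔ (by norm_num)
  -- Outside the interval `x²/Δ² ≥ 400`. Half of the exponent gives `exp(-200) ≤ 1/201`; the other
  -- half is a Gaussian of mass `√2 ≤ 2`, so the loss is at most `2/201 < 1/100`.
  have hle : ∀ x, peak Δ x ^ 2 ≤ f x + 1 / 201 *
      (1 / (√Real.pi * Δ) * Real.exp (-(1 / 2 / Δ ^ 2) * x ^ 2)) := by
    intro x
    by_cases h : x ∈ Set.Icc (-ε) ε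
    · simp only [f, h, Set.indicator_of_mem]
      have : 0 ≤ 1 / 201 * (1 / (√Real.pi * Δ) * Real.exp (-(1 / 2 / Δ ^ 2) * x ^ 2)) := by
        positivity
      linarith
    · have hx : ε < |x| := by
        by_contra hx
        exact h (abs_le.1 (not_lt.1 hx))
      have hx2 : 400 * Δ ^ 2 ≤ x ^ 2 := by
        rw [← sq_abs x]
        nlinarith
      have hx3 : 400 ≤ 1 / Δ ^ 2 * x ^ 2 := by
        rw [one_div_mul_eq_div, le_div_iff₀ (by positivity)]
        exact hx2
      have he : Real.exp (-(1 / 2 * (1 / Δ ^ 2 * x ^ 2))) ≤ 1 / 201 := by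
        rw [Real.exp_neg, inv_eq_one_div]
        refine one_div_le_one_div_of_le (by norm_num) ?_
        linarith [Real.add_one_le_exp (1 / 2 * (1 / Δ ^ 2 * x ^ 2))]
      have hsplit : Real.exp (-(1 / Δ ^ 2) * x ^ 2) =
          Real.exp (-(1 / 2 * (1 / Δ ^ 2 * x ^ 2))) * Real.exp (-(1 / 2 / Δ ^ 2) * x ^ 2) := by
        rw [← Real.exp_add]; congr 1; ring
      have hf0 : f x = 0 := by simp [f, h]
      rw [hf0, zero_add, peak_sq hΔ, hsplit, mul_left_comm]
      exact mul_le_mul_of_nonneg_right he (by positivity)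
  have h1 := integral_mono hpeak (hf.add (htail.const_mul (1 / 201))) hle
  have h2 : ∫ x, peak Δ x ^ 2 = 1 := by
    simp only [peak_sq hΔ]
    rw [integral_peak_normalized_gaussian hΔ]; norm_num
  have h3 : √(1 / (1 / 2) : ℝ) ≤ 2 := by
    rw [Real.sqrt_le_left (by norm_num)]; norm_num
  simp only [Pi.add_apply] at h1
  rw [integral_add hf (htail.const_mul _), integral_const_mul,
    integral_peak_normalized_gaussian hΔ, h2] at h1
  linarith

theorem truncPeak_sq_le {Δ ε : ℝ} (hΔ : 0 < Δ) (hε : 20 * Δ ≤ ε) (x : ℝ) :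
    truncPeak Δ ε x ^ 2 ≤ 100 / 99 * peak Δ x ^ 2 := by
  rw [truncPeak, normalize, mul_pow, inv_pow]
  refine mul_le_mul ?_ (indicator_peak_sq_le Δ ε x) (sq_nonneg _) (by norm_num)
  have h := le_sq_l2norm_truncated_peak hΔ hε
  rw [inv_le_comm₀ (by linarith) (by norm_num)]
  linarith

/-- The exponents add to `1 + 1/4 = 5/4`, and `100/99 · √(4/5) ≤ 100/99 · 9/10 = 10/11 < 23/25`. -/
theorem integral_truncPeak_sq_mul_gaussian_le {Δ ε : ℝ} (hΔ : 0 < Δ) (hε : 20 * Δ ≤ ε) :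
    ∫ x, truncPeak Δ ε x ^ 2 * Real.exp (-(1 / 4 / Δ ^ 2) * x ^ 2) ≤ 23 / 25 := by
  have hg := (integrable_peak_normalized_gaussian (b := 5 / 4) hΔ (by norm_num)).const_mul (100 / 99)
  refine (integral_mono_of_nonneg (Filter.Eventually.of_forall fun x => by positivity) hg
    (Filter.Eventually.of_forall fun x => ?_)).trans ?_
  · have h : Real.exp (-(5 / 4 / Δ ^ 2) * x ^ 2) =
        Real.exp (-(1 / Δ ^ 2) * x ^ 2) * Real.exp (-(1 / 4 / Δ ^ 2) * x ^ 2) := by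
      rw [← Real.exp_add]; congr 1; ring
    have h' := mul_le_mul_of_nonneg_right (truncPeak_sq_le hΔ hε x)
      (Real.exp_pos (-(1 / 4 / Δ ^ 2) * x ^ 2)).le
    rw [peak_sq hΔ] at h'
    simp only [h]
    linarith
  · rw [integral_const_mul, integral_peak_normalized_gaussian hΔ]
    have : √(1 / (5 / 4) : ℝ) ≤ 9 / 10 := by
      rw [Real.sqrt_le_left (by norm_num)]; norm_num
    linarith

/-- The phase is discarded: damping by the Poisson sum alone suffices. Its central term contributes
at most `23/25`, the remaining terms at most `1/100`. -/
theorem norm_integral_comb_sq_mul_latticePhase_le {d : ℕ} (hd : 2 ≤ d) {κ Δ : ℝ} (hκ : 0 < κ)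
    (hΔ : 0 < Δ) (hκ1 : κ ≤ 1 / 10) (hΔd : Δ ≤ 1 / (40 * d)) (hκΔ : κ ≤ 2 * Real.pi * d * Δ) :
    ‖∫ x, ((comb κ Δ (1 / (2 * d)) x ^ 2 : ℝ) : ℂ) * latticePhase d x‖ ≤ 93 / 100 := by
  have hd0 : (2 : ℝ) ≤ d := by exact_mod_cast hd
  have hπ := Real.pi_gt_three
  have hε0 := one_div_two_mul_pos hd
  have hε : 20 * Δ ≤ 1 / (2 * (d : ℝ)) := by
    refine (mul_le_mul_of_nonneg_left hΔd (by norm_num)).trans_eq ?_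
    field_simp; norm_num
  rw [integral_comb_sq_mul_latticePhase hκ hΔ hε0 (one_div_two_mul_lt hd)]
  set ε : ℝ := 1 / (2 * (d : ℝ)) with hεdef
  set A : ℝ := Real.pi ^ 2 / κ ^ 2 with hA
  have hA900 : 900 ≤ A := by
    rw [hA, le_div_iff₀ (by positivity)]
    nlinarith
  have hχ := integrable_truncPeak_sq hΔ hε0
  have hG : Integrable fun x => truncPeak Δ ε x ^ 2 * Real.exp (-(1 / 4 / Δ ^ 2) * x ^ 2) := by
    refine hχ.mul_bdd (c := 1) (by fun_prop) (Filter.Eventually.of_forall fun x => ?_)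
    rw [Real.norm_of_nonneg (Real.exp_pos _).le]
    refine Real.exp_le_one_iff.2 ?_
    have : 0 ≤ 1 / 4 / Δ ^ 2 * x ^ 2 := by positivity
    linarith
  -- The only use of `κ ≤ 2πdΔ`: it makes the central term `exp(-A (d x)²)` at most
  -- `exp(-x²/(4Δ²))`.
  have hA4 : 1 / 4 / Δ ^ 2 ≤ A * d ^ 2 := by
    rw [hA, div_mul_eq_mul_div, div_le_div_iff₀ (by positivity) (by positivity)]
    have : κ ^ 2 ≤ (2 * Real.pi * d * Δ) ^ 2 := pow_le_pow_left₀ hκ.le hκΔ 2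
    linarith
  refine (norm_integral_le_of_norm_le (hG.add (hχ.mul_const (1 / 100)))
    (Filter.Eventually.of_forall fun x => ?_)).trans ?_
  · rw [norm_mul, norm_latticePhase, mul_one, Complex.norm_real, Real.norm_of_nonneg
      (mul_nonneg (sq_nonneg _) (tsum_nonneg fun _ => (Real.exp_pos _).le)), Pi.add_apply,
      ← mul_add]
    by_cases hx : |x| ≤ ε
    · refine mul_le_mul_of_nonneg_left ?_ (sq_nonneg _)
      -- The truncation radius `1/(2d)` keeps `d x` in the fundamental domain of `ℤ`, where `n = 0`
      -- dominates.
      have hs : |(d : ℝ) * x| ≤ 1 / 2 := by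
        rw [abs_mul, abs_of_pos (by linarith)]
        refine (mul_le_mul_of_nonneg_left hx (by linarith)).trans_eq ?_
        rw [hεdef]; field_simp
      refine (tsum_exp_neg_mul_sub_sq_le hA900 hs).trans ?_
      refine add_le_add (Real.exp_le_exp.2 ?_) le_rfl
      nlinarith [mul_le_mul_of_nonneg_right hA4 (sq_nonneg x)]
    · rw [truncPeak_of_abs_gt (not_le.1 hx)]
      simp
  · simp only [Pi.add_apply]
    rw [integral_add hG (hχ.mul_const _), integral_mul_const, integral_truncPeak_sq hΔ hε0]
    linarith [integral_truncPeak_sq_mul_gaussian_le hΔ hε]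

/-- Substitute `x = α y` with `α² = 2πd`: then `x²/2 = πd y²`, and `√(2π/d) α = 2π` turns the linear
term into `π c_d y`. The prefactor is the squared normalization of the comb. -/
theorem inner_gkpState_zero_phaseGateUnitary {κ Δ ε : ℝ} (hκ : 0 < κ) (hΔ : 0 < Δ) (hε0 : 0 < ε)
    (hε : ε < 1 / 2) {d : ℕ} (hd : 0 < d) :
    ⟪gkpState hκ hΔ hε hd ⟨0, hd⟩, phaseGateUnitary d (gkpState hκ hΔ hε hd ⟨0, hd⟩)⟫_ℂ =
      ((∑' z : ℤ, envelope κ z ^ 2 : ℝ) : ℂ)⁻¹ *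
        ∫ x, ((comb κ Δ ε x ^ 2 : ℝ) : ℂ) * latticePhase d x := by
  have hπ := Real.pi_pos
  have hd0 : (0 : ℝ) < d := by exact_mod_cast hd
  set α := √(2 * Real.pi * d) with hα
  have hα0 : 0 < α := by positivity
  have hα2 : α ^ 2 = 2 * Real.pi * d := Real.sq_sqrt (by positivity)
  have hshift : √(2 * Real.pi / d) * α = 2 * Real.pi := by
    rw [hα, ← Real.sqrt_mul (by positivity)]
    have : 2 * Real.pi / d * (2 * Real.pi * d) = (2 * Real.pi) ^ 2 := by field_simp
    rw [this, Real.sqrt_sq (by positivity)]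
  have hN : l2norm (comb κ Δ ε) ^ 2 = ∑' z : ℤ, envelope κ z ^ 2 := by
    rw [l2norm, Real.sq_sqrt (integral_nonneg fun _ => sq_nonneg _),
      integral_comb_sq hκ hΔ hε0 hε]
  set G : ℝ → ℂ := fun y => ((gkpInt κ Δ ε y ^ 2 : ℝ) : ℂ) * latticePhase d y with hG
  have hinner : ⟪gkpState hκ hΔ hε hd ⟨0, hd⟩,
      phaseGateUnitary d (gkpState hκ hΔ hε hd ⟨0, hd⟩)⟫_ℂ = ∫ x, (α : ℂ)⁻¹ * G (x / α) := by
    rw [MeasureTheory.L2.inner_def]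
    refine integral_congr_ae ?_
    have hφ : Measurable fun x : ℝ =>
        (x ^ 2 + (d % 2 : ℕ) * √(2 * Real.pi / d) * x) / 2 := by fun_prop
    filter_upwards [(memLp_gkpFun hκ hΔ hε hd 0).coeFn_toLp,
      coeFn_phaseMul hφ (gkpState hκ hΔ hε hd ⟨0, hd⟩)] with x h1 h2
    have h3 : (phaseGateUnitary d (gkpState hκ hΔ hε hd ⟨0, hd⟩)) x =
        Complex.exp (Complex.I * ((x ^ 2 + (d % 2 : ℕ) * √(2 * Real.pi / d) * x) / 2 : ℝ)) *
          gkpState hκ hΔ hε hd ⟨0, hd⟩ x := h2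
    have h4 : gkpState hκ hΔ hε hd ⟨0, hd⟩ x = (gkpFun κ Δ ε d 0 x : ℂ) := h1
    have h5 := gkpFun_sq κ Δ ε d 0 x
    rw [← hα, Nat.cast_zero, zero_mul, sub_zero] at h5
    have h6 : Real.pi * d * (x / α) ^ 2 + Real.pi * (d % 2 : ℕ) * (x / α) =
        (x ^ 2 + (d % 2 : ℕ) * √(2 * Real.pi / d) * x) / 2 := by
      have e1 : Real.pi * d = α ^ 2 / 2 := by rw [hα2]; ring
      have e2 : Real.pi = √(2 * Real.pi / d) * α / 2 := by rw [hshift]; ring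
      rw [e1]
      nth_rewrite 1 [e2]
      field_simp
    rw [h3, h4]
    simp only [hG, latticePhase]
    rw [h6, ← mul_assoc, ← Complex.ofReal_inv, ← Complex.ofReal_mul, ← h5]
    simp only [RCLike.inner_apply, Complex.conj_ofReal]
    push_cast
    ring
  rw [hinner, integral_const_mul, Measure.integral_comp_div G, abs_of_pos hα0, Complex.real_smul,
    ← mul_assoc, inv_mul_cancel₀ (by exact_mod_cast hα0.ne'), one_mul, ← hN, ← integral_const_mul]
  congr 1
  ext y
  simp only [hG, gkpInt, normalize]
  push_cast
  ring

theorem phaseGate_apply_single_zero {d : ℕ} (hd : 0 < d) :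
    Matrix.toEuclideanCLM (𝕜 := ℂ) (phaseGate d : Matrix (Fin d) (Fin d) ℂ)
      (EuclideanSpace.single ⟨0, hd⟩ 1) = EuclideanSpace.single ⟨0, hd⟩ 1 := by
  ext i
  simp only [phaseGate, Matrix.ofLp_toEuclideanCLM, Matrix.mulVec_diagonal, PiLp.single_apply]
  by_cases h : i = ⟨0, hd⟩
  · subst h; simp
  · simp [h]

/-- The gate error is bounded below as soon as the spread of the peaks exceeds the inverse spread of
the envelope. -/
theorem one_div_fifty_le_gateError {d : ℕ} (hd : 2 ≤ d) {κ Δ : ℝ} (hκ : 0 < κ)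
    (hΔ : 0 < Δ) (hκ1 : κ ≤ 1 / 10) (hΔd : Δ ≤ 1 / (40 * d)) (hκΔ : κ ≤ 2 * Real.pi * d * Δ) :
    1 / 50 ≤ gateError (gkpStarEncoder d hd κ Δ hκ hΔ) (phaseGateUnitary d) (phaseGate d) := by
  have hd0 : 0 < d := by omega
  refine le_trans ?_ (one_sub_sq_le_gateError (gkpStarEncoder d hd κ Δ hκ hΔ) (phaseGateUnitary d)
    (phaseGate d) (v := EuclideanSpace.single ⟨0, hd0⟩ 1) (by simp)
    (phaseGate_apply_single_zero hd0))
  have h50 : (1 / 50 : ℝ≥0∞) = ENNReal.ofReal (1 / 50) := by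
    rw [ENNReal.ofReal_div_of_pos (by norm_num)]; norm_num
  rw [h50]
  refine ENNReal.ofReal_le_ofReal ?_
  rw [gkpStarEncoder, gkpEncoder_single, inner_gkpState_zero_phaseGateUnitary hκ hΔ
    (one_div_two_mul_pos hd) (one_div_two_mul_lt hd) hd0, norm_mul, norm_inv, Complex.norm_real]
  have h1 := norm_integral_comb_sq_mul_latticePhase_le hd hκ hΔ hκ1 hΔd hκΔ
  have h2 : ‖∑' z : ℤ, envelope κ z ^ 2‖⁻¹ ≤ 1 :=
    inv_le_one_of_one_le₀ ((one_le_tsum_envelope_sq hκ).trans (Real.le_norm_self _))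
  have h3 := mul_le_mul h2 h1 (norm_nonneg _) zero_le_one
  -- The square is at most `0.93² = 0.8649`, well below `1 - 1/50`.
  have h4 := pow_le_pow_left₀ (by positivity) h3 2
  linarith

end Bound
end GKP
end

/-! ### The dichotomy between the two codes -/

theorem mainTheorem9 (d : ℕ) (hd : 2 ≤ d) (κ Δ ν : ℝ) (hκ : 0 < κ) (hΔ : 0 < Δ) (hν : 0 < ν)
    (hΔd : Δ ≤ 1 / (80 * (d : ℝ))) (hκd : κ ≤ (d : ℝ) ^ (-(6 + ν))) :
    1 / 50 ≤ max
      (GKP.gateError (GKP.gkpStarEncoder d hd κ Δ hκ hΔ)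
        (GKP.phaseGateUnitary d) (GKP.phaseGate d))
      (GKP.gateError
        (GKP.gkpStarEncoder d hd (2 * Real.pi * d * Δ) (κ / (2 * Real.pi * d))
          (GKP.swapped_kappa_pos hd hΔ) (GKP.swapped_delta_pos hd hκ))
        (GKP.phaseGateUnitary d) (GKP.phaseGate d)) := by
  have hd0 : (2 : ℝ) ≤ d := by exact_mod_cast hd
  have hπ := Real.pi_gt_three
  have hπ4 := Real.pi_lt_d2
  -- In fact `κ ≤ d⁻⁶ ≤ 1/64`.
  have hκ1 : κ ≤ 1 / 10 := by
    refine hκd.trans ((Real.rpow_le_rpow_of_exponent_le (by linarith)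
      (by push_cast; linarith : -(6 + ν) ≤ -((6 : ℕ) : ℝ))).trans ?_)
    rw [Real.rpow_neg (by linarith), Real.rpow_natCast, inv_eq_one_div]
    refine one_div_le_one_div_of_le (by norm_num) ?_
    have : (2 : ℝ) ^ 6 ≤ d ^ 6 := pow_le_pow_left₀ (by norm_num) hd0 6
    linarith
  -- For the swapped parameters `2πdΔ' = κ` and `κ' = 2πdΔ`, so the opposite case is the same
  -- condition for the second code. There `κ' ≤ 2π/80 < 1/10`, and `Δ' ≤ 1/(40d)` amounts to `κ ≤
  -- 2π/40`.
  rcases le_total κ (2 * Real.pi * d * Δ) with h | h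
  · refine le_max_of_le_left (GKP.one_div_fifty_le_gateError hd hκ hΔ hκ1 (hΔd.trans ?_) h)
    exact one_div_le_one_div_of_le (by linarith) (by linarith)
  · refine le_max_of_le_right (GKP.one_div_fifty_le_gateError hd _ _ ?_ ?_ ?_)
    · have : Δ * (80 * d) ≤ 1 := (le_div_iff₀ (by linarith)).1 hΔd
      nlinarith [mul_pos hΔ (by linarith : (0 : ℝ) < d)]
    · rw [div_le_div_iff₀ (by positivity) (by positivity)]
      nlinarith
    · refine h.trans_eq ?_
      field_simp
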